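/- Let $d>2$ be an integer, let $z_0=\frac{1}{2d}$, and for $r\ge 3$ let $\mathbb T_r^d=(\mathbb Z/r\mathbb Z)^d$ be the discrete torus of period $r$. For $z\in[0,z_0)$ let $$C_z(x)=\sum_{n=0}^\infty\sum_{\omega\in\mathcal W_n(x)}z^n\quad(x\in\mathbb Z^d),$$ where $\mathcal W_n(x)$ is the set of $n$-step nearest-neighbour walks on $\mathbb Z^d$ from $0$ to $x$, let $C^{\mathbb T}_z(x)$, $x\in\mathbb T_r^d$, be the analogous sum over nearest-neighbour walks on $\mathbb T_r^d$ from $0$ to $x$, and let $\chi_0(z)=\sum_{x\in\mathbb Z^d}C_z(x)$. For $x\in\mathbb T_r^d$, $C_z(x)$ denotes the value of $C_z$ at the representative of $x$ in $[-r/2,r/2)^d\cap\mathbb Z^d$. **Theorem.** All constants below depend only on $d$. (a) If $d\neq 4$, there are constants $c_1',c_2',c_3'>0$ such that, for all $r\ge 3$ and all $x\in\mathbb T_r^d$, $$C_z(x)+c_1'\frac{\chi_0(z)}{r^d}\;\le\; C_z^{\mathbb T}(x)\;\le\; C_z(x)+c_2'\frac{\chi_0(z)}{r^d},$$ where the upper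 bound holds for all $z\in(0,z_0)$, and the lower bound holds for all $z\in[z_0-c_3'r^{-2},z_0)$. (b) If $d=4$, there are constants $c_1',c_2',\varepsilon>0$ such that, for all $r\ge 3$, all $x\in\mathbb T_r^d$ and all $z\in(0,z_0)$, $$C_z^{\mathbb T}(x)\le C_z(x)+c_2'\frac{\chi_0(z)}{r^d},$$ and, if in addition $\rho\,|\log\rho|\,r^2\le\varepsilon$ where $\rho=z_0-z$, $$C_z(x)+c_1'\frac{\chi_0(z)}{r^d}\,\frac{1}{\log\chi_0(z)}\le C_z^{\mathbb T}(x).$$ -/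

import Mathlib

noncomputable section

/-- A nearest-neighbour step, i.e. one of the vectors `e_j`, `-e_j`. It is used with `R = ℤ`
(the lattice `ℤ^d`) and with `R = ZMod r` (the discrete torus `(ℤ/rℤ)^d`). -/
def IsUnitStep {d : ℕ} {R : Type} [Ring R] (v : Fin d → R) : Prop :=
  ∃ j : Fin d, v = Pi.single j 1 ∨ v = Pi.single j (-1)

/-- The set of `n`-step nearest-neighbour walks `(ω(0), …, ω(n))` from `0` to `x`. -/
def srwWalks {d : ℕ} {R : Type} [Ring R] (n : ℕ) (x : Fin d → R) :
    Set (Fin (n + 1) → Fin d → R) :=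
  {ω | ω 0 = 0 ∧ ω (Fin.last n) = x ∧ ∀ i : Fin n, IsUnitStep (ω i.succ - ω i.castSucc)}

/-- The simple random walk two-point function `∑_{n ≥ 0} ∑_{ω ∈ 𝒲_n(x)} z ^ n`. -/
def srwTwoPoint {d : ℕ} {R : Type} [Ring R] (z : ℝ) (x : Fin d → R) : ℝ :=
  ∑' n : ℕ, ((srwWalks n x).ncard : ℝ) * z ^ n

/-- The lattice Green function `C_z(x)` on `ℤ^d`. -/
def latticeGreen (d : ℕ) (z : ℝ) (x : Fin d → ℤ) : ℝ := srwTwoPoint z x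

/-- The torus Green function on `(ℤ/rℤ)^d`. -/
def torusGreen (d r : ℕ) (z : ℝ) (x : Fin d → ZMod r) : ℝ := srwTwoPoint z x

/-- The susceptibility `χ₀(z) = ∑_{x ∈ ℤ^d} C_z(x)`. -/
def srwSusceptibility (d : ℕ) (z : ℝ) : ℝ := ∑' x : Fin d → ℤ, latticeGreen d z x

/-- The critical value `z₀ = 1 / (2d)`. -/
def srwCritical (d : ℕ) : ℝ := 1 / (2 * (d : ℝ))

/-- The representative of a torus point in `[-r/2, r/2)^d ∩ ℤ^d`. -/
def torusRep {d r : ℕ} (x : Fin d → ZMod r) : Fin d → ℤ :=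
  fun j => Int.bmod ((x j).val : ℤ) r

theorem torusRep_spec {d r : ℕ} (hr : 0 < r) (x : Fin d → ZMod r) (j : Fin d) :
    ((torusRep x j : ℤ) : ZMod r) = x j ∧
      -(r : ℤ) ≤ 2 * torusRep x j ∧ 2 * torusRep x j < r := by
  have : NeZero r := ⟨hr.ne'⟩
  have h1 : -((r : ℤ) / 2) ≤ torusRep x j := Int.le_bmod hr
  have h2 : torusRep x j < ((r : ℤ) + 1) / 2 := Int.bmod_lt hr
  refine ⟨?_, by omega, by omega⟩
  have h := Int.bmod_emod (x := ((x j).val : ℤ)) (m := r)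
  have h3 : ((torusRep x j : ℤ) : ZMod r) = (((x j).val : ℤ) : ZMod r) :=
    (ZMod.intCast_eq_intCast_iff' _ _ _).2 h
  rw [h3]
  simp

/-- The walk from `0` with a given sequence of coordinate directions and signs. -/
def walkOfSteps {d : ℕ} {R : Type} [Ring R] {n : ℕ} (s : Fin n → Fin d × Bool) :
    Fin (n + 1) → Fin d → R :=
  Fin.induction 0 fun i v => v + Pi.single (s i).1 (if (s i).2 then 1 else -1)

theorem walkOfSteps_zero {d : ℕ} {R : Type} [Ring R] {n : ℕ} (s : Fin n → Fin d × Bool) :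
    walkOfSteps (R := R) s 0 = 0 := rfl

theorem walkOfSteps_succ {d : ℕ} {R : Type} [Ring R] {n : ℕ} (s : Fin n → Fin d × Bool)
    (i : Fin n) : walkOfSteps (R := R) s i.succ =
      walkOfSteps s i.castSucc + Pi.single (s i).1 (if (s i).2 then 1 else -1) := rfl

theorem exists_walkOfSteps {d : ℕ} {R : Type} [Ring R] {n : ℕ} {x : Fin d → R}
    {ω : Fin (n + 1) → Fin d → R} (h : ω ∈ srwWalks n x) :
    ∃ s : Fin n → Fin d × Bool, walkOfSteps s = ω := by
  obtain ⟨h0, -, hs⟩ := h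
  have key : ∀ i : Fin n, ∃ p : Fin d × Bool,
      ω i.succ - ω i.castSucc = Pi.single p.1 (if p.2 then 1 else -1) := by
    intro i
    obtain ⟨j, hj | hj⟩ := hs i
    · exact ⟨(j, true), by simpa using hj⟩
    · exact ⟨(j, false), by simpa using hj⟩
  choose s hs' using key
  refine ⟨s, funext fun k => ?_⟩
  induction k using Fin.induction with
  | zero => rw [walkOfSteps_zero, h0]
  | succ i ih => rw [walkOfSteps_succ, ih, ← hs' i]; abel

theorem walkOfSteps_mem {d : ℕ} {R : Type} [Ring R] {n : ℕ} (s : Fin n → Fin d × Bool) :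
    walkOfSteps (R := R) s ∈ srwWalks n (walkOfSteps (R := R) s (Fin.last n)) := by
  refine ⟨rfl, rfl, fun i => ⟨(s i).1, ?_⟩⟩
  rw [walkOfSteps_succ]
  cases h : (s i).2 <;> simp

theorem walkOfSteps_injective {d : ℕ} {n : ℕ} :
    Function.Injective (walkOfSteps (d := d) (R := ℤ) (n := n)) := by
  intro s t h
  funext i
  have h1 := congrFun h i.succ
  rw [walkOfSteps_succ, walkOfSteps_succ, congrFun h i.castSucc] at h1
  have h2 := add_left_cancel h1
  have h3 := congrFun h2 (s i).1
  rcases hs : s i with ⟨a, p⟩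
  rcases ht : t i with ⟨b, q⟩
  rw [hs, ht] at h3
  by_cases hab : a = b
  · subst hab
    cases p <;> cases q <;> simp_all
  · cases p <;> simp [hab] at h3

theorem srwWalks_finite {d : ℕ} {R : Type} [Ring R] (n : ℕ) (x : Fin d → R) :
    (srwWalks n x).Finite :=
  (Set.finite_range (walkOfSteps (d := d) (R := R) (n := n))).subset
    fun _ h => exists_walkOfSteps h

theorem srwWalks_ncard_le {d : ℕ} {R : Type} [Ring R] (n : ℕ) (x : Fin d → R) :
    (srwWalks n x).ncard ≤ (2 * d) ^ n := by
  have h1 : (srwWalks n x).ncard ≤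
      (Set.range (walkOfSteps (d := d) (R := R) (n := n))).ncard :=
    Set.ncard_le_ncard (fun _ h => exists_walkOfSteps h) (Set.finite_range _)
  refine h1.trans ?_
  rw [← Set.image_univ]
  refine (Set.ncard_image_le Set.finite_univ).trans ?_
  simp [Set.ncard_univ, mul_comm]

/-- The series defining both Green functions converge for `0 ≤ z < z₀`. -/
theorem summable_srwTwoPoint {d : ℕ} {R : Type} [Ring R] {z : ℝ} (hz : 0 ≤ z)
    (hz' : z < srwCritical d) (x : Fin d → R) :
    Summable fun n : ℕ => ((srwWalks n x).ncard : ℝ) * z ^ n := by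
  have hlt : 2 * (d : ℝ) * z < 1 := by
    rcases Nat.eq_zero_or_pos d with rfl | hd
    · simp
    · have : (0 : ℝ) < 2 * d := by positivity
      rw [srwCritical, lt_div_iff₀ this] at hz'
      linarith
  refine Summable.of_nonneg_of_le (fun n => by positivity) (fun n => ?_)
    (summable_geometric_of_lt_one (by positivity) hlt)
  rw [mul_pow]
  refine mul_le_mul_of_nonneg_right ?_ (by positivity)
  exact_mod_cast srwWalks_ncard_le n x

theorem hasSum_srwWalks_ncard (d n : ℕ) :
    HasSum (fun x : Fin d → ℤ => ((srwWalks n x).ncard : ℝ)) ((2 * (d : ℝ)) ^ n) := by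
  classical
  let e : (Fin n → Fin d × Bool) → (Fin d → ℤ) := fun s => walkOfSteps s (Fin.last n)
  have hc : ∀ x : Fin d → ℤ, (srwWalks n x).ncard = (Finset.univ.filter fun s => e s = x).card := by
    intro x
    have : srwWalks n x = walkOfSteps '' ((Finset.univ.filter fun s => e s = x : Finset _) :
        Set (Fin n → Fin d × Bool)) := by
      ext ω
      constructor
      · intro h
        obtain ⟨s, rfl⟩ := exists_walkOfSteps h
        exact ⟨s, by simpa [e] using h.2.1, rfl⟩
      · rintro ⟨s, hs, rfl⟩
        have hs' : e s = x := by simpa using hs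
        rw [← hs']
        exact walkOfSteps_mem s
    rw [this, Set.ncard_image_of_injective _ walkOfSteps_injective, Set.ncard_coe_finset]
  have hsum : ∑ x ∈ Finset.univ.image e, ((srwWalks n x).ncard : ℝ) = (2 * (d : ℝ)) ^ n := by
    have h := Finset.card_eq_sum_card_image e (Finset.univ : Finset (Fin n → Fin d × Bool))
    simp only [hc]
    rw [← Nat.cast_sum, ← h]
    simp [mul_comm]
  rw [← hsum]
  refine hasSum_sum_of_ne_finset_zero fun x hx => ?_
  rw [hc, Nat.cast_eq_zero, Finset.card_eq_zero, Finset.filter_eq_empty_iff]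
  intro s _ hs
  exact hx (Finset.mem_image.2 ⟨s, Finset.mem_univ _, hs⟩)

/-- The susceptibility is a convergent sum with value `1 / (1 - 2dz)` for `0 ≤ z < z₀`. -/
theorem hasSum_latticeGreen {d : ℕ} {z : ℝ} (hz : 0 ≤ z) (hz' : z < srwCritical d) :
    HasSum (fun x : Fin d → ℤ => latticeGreen d z x) (1 / (1 - 2 * (d : ℝ) * z)) := by
  have hlt : 2 * (d : ℝ) * z < 1 := by
    rcases Nat.eq_zero_or_pos d with rfl | hd
    · simp
    · have : (0 : ℝ) < 2 * d := by positivity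
      rw [srwCritical, lt_div_iff₀ this] at hz'
      linarith
  have hin : ∀ n : ℕ, HasSum (fun x : Fin d → ℤ => ((srwWalks n x).ncard : ℝ) * z ^ n)
      ((2 * (d : ℝ) * z) ^ n) := fun n => by
    rw [mul_pow]; exact (hasSum_srwWalks_ncard d n).mul_right _
  have hg : HasSum (fun n : ℕ => (2 * (d : ℝ) * z) ^ n) (1 / (1 - 2 * (d : ℝ) * z)) := by
    rw [one_div]; exact hasSum_geometric_of_lt_one (by positivity) hlt
  have hp : Summable (fun p : ℕ × (Fin d → ℤ) => ((srwWalks p.1 p.2).ncard : ℝ) * z ^ p.1) := by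
    rw [summable_prod_of_nonneg (fun p => by positivity)]
    refine ⟨fun n => (hin n).summable, ?_⟩
    simpa only [(hin _).tsum_eq] using hg.summable
  have h1 : HasSum (fun p : ℕ × (Fin d → ℤ) => ((srwWalks p.1 p.2).ncard : ℝ) * z ^ p.1)
      (1 / (1 - 2 * (d : ℝ) * z)) := by
    have := hp.hasSum.prod_fiberwise hin
    rw [← this.unique hg]
    exact hp.hasSum
  have h2 := (Equiv.prodComm (Fin d → ℤ) ℕ).hasSum_iff.2 h1
  exact h2.prod_fiberwise fun x => (summable_srwTwoPoint hz hz' x).hasSum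

theorem srwSusceptibility_eq {d : ℕ} {z : ℝ} (hz : 0 ≤ z) (hz' : z < srwCritical d) :
    srwSusceptibility d z = 1 / (1 - 2 * (d : ℝ) * z) :=
  (hasSum_latticeGreen hz hz').tsum_eq

end

noncomputable section

/-! Poissonise the walk. Writing `n!` as `∫ e^{-t} t^n` turns `∑ |W_n(x)| z^n` into an integral of
the exponential generating function of the counts at `zt`, and that function factorises over
coordinates (`coeff_prod_lineEgf`). Hence (`srwTwoPoint_eq_integral`) each Green function is `∫
e^{-(1-2dz)t} ∏_j p_{zt}(x_j) dt`, with `p` the one-dimensional heat kernel `heatLine` on `ℤ` or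
`ZMod r`. As `χ₀ = 1/(1-2dz) = ∫ e^{-(1-2dz)t} dt`, it suffices to compare products of heat kernels
at each fixed time.

Upper bound (`prod_heatLine_sub_le`): the torus product exceeds the lattice product by at most `c
r^{-d}`, uniformly in time `s`. For `s > r²` every torus factor is `O(1/r)`. For `s ≤ r²` the excess
comes from periodic images at distance at least `r/2`; an exponential tilt shows they are
exponentially small in `r/√(1+s)`.

Lower bound (`le_prod_heatLine_sub`): once `s ≥ 256 r²` the torus kernel is close to `1/r` while the
lattice kernel is much smaller, so the excess is at least `(4r)^{-d}`. Near criticality the times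
beyond a multiple of `r²` carry a fixed proportion of the mass of `e^{-(1-2dz)t}`.

Neither bound distinguishes dimensions; the `d = 4` lower bound is deduced from the same estimate
because `log χ₀ ≥ 1` in the given window. -/

/-! ### Walk counts through step sequences. -/

theorem walkOfSteps_injective_of_one_ne_neg_one {d : ℕ} {R : Type} [Ring R]
    (h2 : (1 : R) ≠ -1) {n : ℕ} :
    Function.Injective (walkOfSteps (d := d) (R := R) (n := n)) := by
  have h10 : (1 : R) ≠ 0 := fun h => h2 (by rw [h, neg_zero])
  have h10' : (-1 : R) ≠ 0 := neg_ne_zero.2 h10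
  intro s t h
  funext i
  have h1 := congrFun h i.succ
  rw [walkOfSteps_succ, walkOfSteps_succ, congrFun h i.castSucc] at h1
  have h3 := congrFun (add_left_cancel h1) (s i).1
  rcases hs : s i with ⟨a, p⟩
  rcases ht : t i with ⟨b, q⟩
  rw [hs, ht] at h3
  by_cases hab : a = b
  · subst hab
    cases p <;> cases q <;> simp_all [eq_comm]
  · cases p <;> simp [hab, h10] at h3

theorem walkOfSteps_castSucc {d : ℕ} {R : Type} [Ring R] {n : ℕ}
    (s : Fin n → Fin d × Bool) (p : Fin d × Bool) (i : Fin (n + 1)) :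
    walkOfSteps (R := R) (Fin.snoc s p : Fin (n + 1) → Fin d × Bool) i.castSucc =
      walkOfSteps s i := by
  induction i using Fin.induction with
  | zero => rfl
  | succ i ih =>
    rw [walkOfSteps_succ, ← ih, ← Fin.succ_castSucc, walkOfSteps_succ, Fin.snoc_castSucc]

-- The condition `1 ≠ -1` makes the `2d` steps distinct, so walks correspond to step sequences; in
-- `ZMod r` it holds because `r ≥ 3`.
open Classical in
theorem ncard_srwWalks_eq_sum {d : ℕ} {R : Type} [Ring R] (h2 : (1 : R) ≠ -1) (n : ℕ)
    (x : Fin d → R) : ((srwWalks n x).ncard : ℝ) =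
      ∑ s : Fin n → Fin d × Bool, if walkOfSteps s (Fin.last n) = x then 1 else 0 := by
  have : srwWalks n x = walkOfSteps '' ((Finset.univ.filter fun s : Fin n → Fin d × Bool =>
      walkOfSteps s (Fin.last n) = x : Finset _) : Set (Fin n → Fin d × Bool)) := by
    ext ω
    constructor
    · intro h
      obtain ⟨s, rfl⟩ := exists_walkOfSteps h
      exact ⟨s, by simpa using h.2.1, rfl⟩
    · rintro ⟨s, hs, rfl⟩
      have hs' : walkOfSteps s (Fin.last n) = x := by simpa using hs
      rw [← hs']
      exact walkOfSteps_mem s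
  rw [this, Set.ncard_image_of_injective _ (walkOfSteps_injective_of_one_ne_neg_one h2),
    Set.ncard_coe_finset, Finset.card_filter]
  push_cast
  rfl

open Classical in
theorem ncard_srwWalks_zero {d : ℕ} {R : Type} [Ring R] (h2 : (1 : R) ≠ -1) (x : Fin d → R) :
    ((srwWalks 0 x).ncard : ℝ) = if x = 0 then 1 else 0 := by
  rw [ncard_srwWalks_eq_sum h2, Fintype.sum_unique]
  simp [walkOfSteps_zero, eq_comm]

theorem ncard_srwWalks_succ {d : ℕ} {R : Type} [Ring R] (h2 : (1 : R) ≠ -1) (n : ℕ)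
    (x : Fin d → R) : ((srwWalks (n + 1) x).ncard : ℝ) =
      ∑ j, (((srwWalks n (x - Pi.single j 1)).ncard : ℝ) +
        (srwWalks n (x + Pi.single j 1)).ncard) := by
  classical
  simp_rw [ncard_srwWalks_eq_sum h2]
  rw [← (Fin.snocEquiv fun _ => Fin d × Bool).sum_comp, Fintype.sum_prod_type,
    Fintype.sum_prod_type]
  refine Finset.sum_congr rfl fun j _ => ?_
  rw [Fintype.sum_bool]
  have hw : ∀ (p : Fin d × Bool) (s : Fin n → Fin d × Bool),
      walkOfSteps (R := R) (Fin.snocEquiv (fun _ => Fin d × Bool) (p, s)) (Fin.last (n + 1)) =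
        walkOfSteps s (Fin.last n) + Pi.single p.1 (if p.2 then 1 else -1) := fun p s => by
    change walkOfSteps (Fin.snoc s p : Fin (n + 1) → Fin d × Bool) (Fin.last n).succ = _
    rw [walkOfSteps_succ, walkOfSteps_castSucc, Fin.snoc_last]
  congr 1 <;>
  · refine Finset.sum_congr rfl fun s _ => if_congr ?_ rfl rfl
    rw [hw]
    simp [eq_sub_iff_add_eq, ← sub_eq_add_neg, sub_eq_iff_eq_add, Pi.single_neg]

/-! ### Factorisation of the exponential generating function over coordinates. -/

open Classical in
/-- The number of `n`-step nearest-neighbour walks from `0` to `x` in one dimension. -/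
def lineCount {R : Type} [Ring R] : ℕ → R → ℝ
  | 0, x => if x = 0 then 1 else 0
  | n + 1, x => lineCount n (x - 1) + lineCount n (x + 1)

theorem lineCount_nonneg {R : Type} [Ring R] (n : ℕ) (x : R) : 0 ≤ lineCount n x := by
  induction n generalizing x with
  | zero => rw [lineCount]; split_ifs <;> norm_num
  | succ n ih => exact add_nonneg (ih _) (ih _)

theorem lineCount_le {R : Type} [Ring R] (n : ℕ) (x : R) : lineCount n x ≤ 2 ^ n := by
  induction n generalizing x with
  | zero => rw [lineCount]; split_ifs <;> norm_num
  | succ n ih => rw [lineCount, pow_succ]; linarith [ih (x - 1), ih (x + 1)]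

/-- The exponential generating function of one-dimensional walk counts. -/
def lineEgf {R : Type} [Ring R] (x : R) : PowerSeries ℝ :=
  PowerSeries.mk fun n => lineCount n x / n.factorial

open PowerSeries in
theorem derivative_lineEgf {R : Type} [Ring R] (x : R) :
    derivative ℝ (lineEgf x) = lineEgf (x - 1) + lineEgf (x + 1) := by
  ext n
  rw [coeff_derivative, map_add]
  simp only [lineEgf, coeff_mk, lineCount, Nat.factorial_succ]
  push_cast
  field_simp

-- A `d`-dimensional walk is an interleaving of `d` one-dimensional ones, which is what multiplying
-- exponential generating functions counts. The multinomials are avoided: by Leibniz, the derivative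
-- of the product obeys the last-step recursion of `ncard_srwWalks_succ`.
open PowerSeries in
theorem coeff_prod_lineEgf {d : ℕ} {R : Type} [Ring R] (h2 : (1 : R) ≠ -1) (n : ℕ)
    (y : Fin d → R) : coeff n (∏ j, lineEgf (y j)) = (srwWalks n y).ncard / n.factorial := by
  induction n generalizing y with
  | zero =>
    rw [ncard_srwWalks_zero h2, coeff_zero_eq_constantCoeff_apply, map_prod]
    simp only [← coeff_zero_eq_constantCoeff_apply, lineEgf, coeff_mk, lineCount]
    by_cases hy : y = 0
    · simp [hy]
    · obtain ⟨j, hj⟩ := Function.ne_iff.1 hy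
      rw [Finset.prod_eq_zero (Finset.mem_univ j)] <;> simp_all
  | succ n ih =>
    have hD : derivative ℝ (∏ j, lineEgf (y j)) =
        ∑ j, (∏ i, lineEgf ((y - Pi.single j 1 : Fin d → R) i) +
          ∏ i, lineEgf ((y + Pi.single j 1 : Fin d → R) i)) := by
      classical
      have key : ∀ s : Finset (Fin d), derivative ℝ (∏ j ∈ s, lineEgf (y j)) =
          ∑ j ∈ s, (∏ i ∈ s, lineEgf ((y - Pi.single j 1 : Fin d → R) i) +
            ∏ i ∈ s, lineEgf ((y + Pi.single j 1 : Fin d → R) i)) := by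
        intro s
        induction s using Finset.induction_on with
        | empty => simp
        | insert a s ha ihs =>
          rw [Finset.prod_insert ha, Derivation.leibniz, ihs, derivative_lineEgf,
            Finset.sum_insert ha, add_comm]
          congr 1
          · rw [Finset.prod_insert ha, Finset.prod_insert ha, smul_eq_mul]
            have h1 : ∏ i ∈ s, lineEgf ((y - Pi.single a 1 : Fin d → R) i) =
                ∏ i ∈ s, lineEgf (y i) :=
              Finset.prod_congr rfl fun i hi => by
                have : i ≠ a := fun h => ha (h ▸ hi)
                simp [this]
            have h2 : ∏ i ∈ s, lineEgf ((y + Pi.single a 1 : Fin d → R) i) =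
                ∏ i ∈ s, lineEgf (y i) :=
              Finset.prod_congr rfl fun i hi => by
                have : i ≠ a := fun h => ha (h ▸ hi)
                simp [this]
            rw [h1, h2]
            simp
            ring
          · rw [smul_eq_mul, Finset.mul_sum]
            refine Finset.sum_congr rfl fun j hj => ?_
            have : a ≠ j := fun h => ha (h ▸ hj)
            rw [Finset.prod_insert ha, Finset.prod_insert ha]
            simp [this, mul_add]
      exact key _
    have h := congrArg (coeff n) hD
    rw [coeff_derivative, map_sum] at h
    simp only [map_add, ih] at h
    rw [ncard_srwWalks_succ h2, Nat.factorial_succ]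
    have hn : (n.factorial : ℝ) ≠ 0 := by positivity
    have hn' : (n : ℝ) + 1 ≠ 0 := by positivity
    rw [eq_div_iff (by positivity)]
    push_cast
    rw [← mul_assoc, h, Finset.sum_mul]
    refine Finset.sum_congr rfl fun j _ => ?_
    field_simp

/-! ### One-dimensional kernels as convergent series. -/

/-- The unnormalised one-dimensional continuous-time heat kernel. -/
def lineKernel {R : Type} [Ring R] (s : ℝ) (x : R) : ℝ :=
  ∑' n : ℕ, lineCount n x / n.factorial * s ^ n

theorem summable_lineKernel {R : Type} [Ring R] {s : ℝ} (hs : 0 ≤ s) (x : R) :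
    Summable fun n : ℕ => lineCount n x / n.factorial * s ^ n := by
  refine Summable.of_nonneg_of_le (fun n => ?_) (fun n => ?_)
    (Real.summable_pow_div_factorial (2 * s))
  · have := lineCount_nonneg n x
    positivity
  · rw [mul_pow, mul_div_right_comm]
    have := lineCount_le n x
    gcongr

theorem lineKernel_nonneg {R : Type} [Ring R] {s : ℝ} (hs : 0 ≤ s) (x : R) :
    0 ≤ lineKernel s x :=
  tsum_nonneg fun n => by
    have := lineCount_nonneg n x
    positivity

/-- Evaluation at `s` is multiplicative by Cauchy products; absolute convergence is carried through
the induction to allow the next factor. -/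
theorem hasSum_coeff_prod {ι : Type*} (F : ι → PowerSeries ℝ) {s : ℝ} (t : Finset ι)
    (hF : ∀ i, Summable fun n => ‖PowerSeries.coeff n (F i) * s ^ n‖) :
    (Summable fun n => ‖PowerSeries.coeff n (∏ i ∈ t, F i) * s ^ n‖) ∧
      HasSum (fun n => PowerSeries.coeff n (∏ i ∈ t, F i) * s ^ n)
        (∏ i ∈ t, ∑' n, PowerSeries.coeff n (F i) * s ^ n) := by
  classical
  induction t using Finset.induction_on with
  | empty =>
    have h : ∀ n, n ≠ 0 → PowerSeries.coeff n (1 : PowerSeries ℝ) * s ^ n = 0 := fun n hn => by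
      simp [PowerSeries.coeff_one, hn]
    refine ⟨?_, ?_⟩
    · refine summable_of_ne_finset_zero (s := {0}) fun n hn => ?_
      simp [PowerSeries.coeff_one, by simpa using hn]
    · simpa using hasSum_single 0 h
  | insert a t ha ih =>
    have hmul : ∀ n, PowerSeries.coeff n (∏ i ∈ insert a t, F i) * s ^ n =
        ∑ p ∈ Finset.HasAntidiagonal.antidiagonal n, (PowerSeries.coeff p.1 (F a) * s ^ p.1) *
          (PowerSeries.coeff p.2 (∏ i ∈ t, F i) * s ^ p.2) := fun n => by
      rw [Finset.prod_insert ha, PowerSeries.coeff_mul, Finset.sum_mul]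
      refine Finset.sum_congr rfl fun p hp => ?_
      rw [← Finset.HasAntidiagonal.mem_antidiagonal.1 hp, pow_add]
      ring
    have hS := summable_norm_sum_mul_antidiagonal_of_summable_norm (hF a) ih.1
    simp_rw [hmul]
    refine ⟨hS, ?_⟩
    rw [Finset.prod_insert ha, ← ih.2.tsum_eq,
      tsum_mul_tsum_eq_tsum_sum_antidiagonal_of_summable_norm (hF a) ih.1]
    exact hS.of_norm.hasSum

theorem hasSum_ncard_srwWalks_div_factorial {d : ℕ} {R : Type} [Ring R] (h2 : (1 : R) ≠ -1)
    {s : ℝ} (hs : 0 ≤ s) (y : Fin d → R) :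
    HasSum (fun n : ℕ => ((srwWalks n y).ncard : ℝ) / n.factorial * s ^ n)
      (∏ j, lineKernel s (y j)) := by
  have h := (hasSum_coeff_prod (fun j => lineEgf (y j)) (s := s) Finset.univ fun j => by
    simpa only [lineEgf, PowerSeries.coeff_mk] using (summable_lineKernel hs (y j)).norm).2
  simp only [coeff_prod_lineEgf h2] at h
  simpa only [lineEgf, lineKernel, PowerSeries.coeff_mk] using h

theorem hasSum_of_eq {ι E : Type*} [AddCommMonoid E] [TopologicalSpace E] {f g : ι → E} {a : E}
    (h : ∀ i, f i = g i) (hg : HasSum g a) : HasSum f a := by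
  rwa [funext h]

/-- Tonelli for series, used to interchange the sum over walk lengths with the sum over periodic
images. -/
theorem hasSum_tsum_of_nonneg {ι : Type*} {f : ℕ → ι → ℝ} {G : ℕ → ℝ} {T : ℝ}
    (h0 : ∀ n u, 0 ≤ f n u) (hf : ∀ n, HasSum (f n) (G n)) (hG : HasSum G T) :
    HasSum (fun u => ∑' n, f n u) T := by
  have hp : Summable (fun p : ℕ × ι => f p.1 p.2) := by
    rw [summable_prod_of_nonneg (fun p => h0 _ _)]
    exact ⟨fun n => (hf n).summable, by simpa only [(hf _).tsum_eq] using hG.summable⟩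
  have h1 : HasSum (fun p : ℕ × ι => f p.1 p.2) T := by
    rw [← (hp.hasSum.prod_fiberwise hf).unique hG]
    exact hp.hasSum
  have h2 := (Equiv.prodComm ι ℕ).hasSum_iff.2 h1
  exact h2.prod_fiberwise fun u => (h2.summable.prod_factor u).hasSum

/-! ### Periodisation and discrete Fourier analysis of tilted kernels. -/

/-- The discrete Fourier character `exp (-2πi j k / r)`. -/
def dftChar (r j : ℕ) (k : ℤ) : ℂ := Complex.exp (-(2 * Real.pi * j / r * k * Complex.I))

theorem norm_dftChar (r j : ℕ) (k : ℤ) : ‖dftChar r j k‖ = 1 := by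
  have : -(2 * Real.pi * j / r * k * Complex.I : ℂ) =
      ((-(2 * Real.pi * j / r * k) : ℝ) : ℂ) * Complex.I := by push_cast; ring
  rw [dftChar, this, Complex.norm_exp_ofReal_mul_I]

theorem sum_dftChar {r : ℕ} (hr : 0 < r) (k : ℤ) :
    ∑ j ∈ Finset.range r, dftChar r j k = if (r : ℤ) ∣ k then (r : ℂ) else 0 := by
  have hr' : (r : ℂ) ≠ 0 := by exact_mod_cast hr.ne'
  have hpow : ∀ j, dftChar r j k = dftChar r 1 k ^ j := fun j => by
    rw [dftChar, dftChar, ← Complex.exp_nat_mul]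
    congr 1
    push_cast
    ring
  have hone : dftChar r r k = 1 := by
    rw [dftChar, Complex.exp_eq_one_iff]
    refine ⟨-k, ?_⟩
    field_simp
    push_cast
    ring
  have hiff : dftChar r 1 k = 1 ↔ (r : ℤ) ∣ k := by
    rw [dftChar, Complex.exp_eq_one_iff]
    have hpi : (2 * Real.pi * Complex.I : ℂ) ≠ 0 := Complex.two_pi_I_ne_zero
    constructor
    · rintro ⟨n, hn⟩
      refine ⟨-n, ?_⟩
      have h1 : (2 * Real.pi * Complex.I : ℂ) * k = (2 * Real.pi * Complex.I) * (r * -n) := by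
        have : (2 * Real.pi * Complex.I : ℂ) * k =
            -(r * -(2 * Real.pi * (1 : ℕ) / r * k * Complex.I)) := by
          field_simp
          push_cast
          ring
        rw [this, hn]
        ring
      exact_mod_cast mul_left_cancel₀ hpi h1
    · rintro ⟨n, rfl⟩
      refine ⟨-n, ?_⟩
      field_simp
      push_cast
      ring
  rw [Finset.sum_congr rfl fun j _ => hpow j]
  split_ifs with h
  · rw [hiff.2 h]
    simp
  · have h1 : dftChar r 1 k - 1 ≠ 0 := sub_ne_zero.2 fun h' => h (hiff.1 h')
    have := mul_geom_sum (dftChar r 1 k) r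
    rw [← hpow r, hone, sub_self] at this
    exact (mul_eq_zero.1 this).resolve_left h1

/-- A tilted periodised count is determined by its initial value and recursion. Leaving `g` abstract
lets the same induction serve the Fourier expression `tiltedCount` and, at `a = 0`, the torus
counts. -/
theorem hasSum_tilted_lineCount {r : ℕ} (hr : 0 < r) (a : ℝ) {g : ℕ → ℤ → ℂ}
    (h0 : ∀ k, g 0 k = if (r : ℤ) ∣ k then 1 else 0)
    (hg : ∀ n k, g (n + 1) k =
      Complex.exp a * g n (k - 1) + Complex.exp (-a) * g n (k + 1)) (n : ℕ) (k : ℤ) :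
    HasSum (fun u : ℤ => ((Real.exp (a * (k + r * u : ℤ)) * lineCount n (k + r * u) : ℝ) : ℂ))
      (g n k) := by
  induction n generalizing k with
  | zero =>
    have hr' : (r : ℤ) ≠ 0 := by exact_mod_cast hr.ne'
    rw [h0]
    split_ifs with h
    · obtain ⟨m, rfl⟩ := h
      have key : ∀ u : ℤ, (r : ℤ) * m + r * u = 0 ↔ u = -m := fun u => by
        rw [← mul_add, mul_eq_zero, or_iff_right hr']
        constructor <;> intro h <;> linarith
      convert hasSum_ite_eq (-m) (1 : ℂ) using 2 with u
      by_cases hu : u = -m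
      · simp [lineCount, hu]
      · simp [lineCount, hu, key]
    · convert hasSum_zero using 2 with u
      have : k + r * u ≠ 0 := fun hk => h ⟨-u, by linarith⟩
      simp [lineCount, this]
  | succ n ih =>
    rw [hg]
    refine hasSum_of_eq (fun u => ?_) (((ih (k - 1)).mul_left (Complex.exp a)).add
      ((ih (k + 1)).mul_left (Complex.exp (-a))))
    rw [lineCount]
    have h1 : Real.exp (a * (k + r * u : ℤ)) =
        Real.exp a * Real.exp (a * (k - 1 + r * u : ℤ)) := by
      rw [← Real.exp_add]; push_cast; ring_nf
    have h2 : Real.exp (a * (k + r * u : ℤ)) =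
        Real.exp (-a) * Real.exp (a * (k + 1 + r * u : ℤ)) := by
      rw [← Real.exp_add]; push_cast; ring_nf
    rw [mul_add]
    nth_rewrite 1 [h1]
    rw [h2, show k + r * u - 1 = k - 1 + r * u by ring,
      show k + r * u + 1 = k + 1 + r * u by ring]
    push_cast
    ring

/-- The Fourier expression for the periodisation of the exponentially tilted kernel. -/
def tiltedPeriod (r : ℕ) (a s : ℝ) (k : ℤ) : ℂ :=
  (r : ℂ)⁻¹ * ∑ j ∈ Finset.range r,
    Complex.exp (2 * s * Complex.cosh (a + 2 * Real.pi * j / r * Complex.I)) * dftChar r j k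

/-- The Fourier expression for the periodisation of the exponentially tilted walk counts. -/
def tiltedCount (r : ℕ) (a : ℝ) (n : ℕ) (k : ℤ) : ℂ :=
  (r : ℂ)⁻¹ * ∑ j ∈ Finset.range r,
    (2 * Complex.cosh (a + 2 * Real.pi * j / r * Complex.I)) ^ n * dftChar r j k

theorem tiltedCount_zero {r : ℕ} (hr : 0 < r) (a : ℝ) (k : ℤ) :
    tiltedCount r a 0 k = if (r : ℤ) ∣ k then 1 else 0 := by
  have hr' : (r : ℂ) ≠ 0 := by exact_mod_cast hr.ne'
  simp only [tiltedCount, pow_zero, one_mul, sum_dftChar hr]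
  split_ifs <;> simp [hr']

theorem tiltedCount_succ (r : ℕ) (a : ℝ) (n : ℕ) (k : ℤ) :
    tiltedCount r a (n + 1) k = Complex.exp a * tiltedCount r a n (k - 1) +
      Complex.exp (-a) * tiltedCount r a n (k + 1) := by
  simp only [tiltedCount]
  rw [mul_left_comm (Complex.exp a), mul_left_comm (Complex.exp (-a)), ← mul_add,
    Finset.mul_sum (a := Complex.exp a), Finset.mul_sum (a := Complex.exp (-a)),
    ← Finset.sum_add_distrib]
  congr 1
  refine Finset.sum_congr rfl fun j _ => ?_
  have h1 : dftChar r j (k - 1) = dftChar r j k *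
      Complex.exp (2 * Real.pi * j / r * Complex.I) := by
    rw [dftChar, dftChar, ← Complex.exp_add]; push_cast; ring_nf
  have h2 : dftChar r j (k + 1) = dftChar r j k *
      Complex.exp (-(2 * Real.pi * j / r * Complex.I)) := by
    rw [dftChar, dftChar, ← Complex.exp_add]; push_cast; ring_nf
  rw [pow_succ, Complex.cosh, h1, h2, neg_add, Complex.exp_add, Complex.exp_add]
  ring

theorem hasSum_tiltedCount (r : ℕ) (a s : ℝ) (k : ℤ) :
    HasSum (fun n : ℕ => tiltedCount r a n k / n.factorial * (s : ℂ) ^ n)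
      (tiltedPeriod r a s k) := by
  have h : ∀ j ∈ Finset.range r, HasSum (fun n : ℕ =>
      (2 * Complex.cosh (a + 2 * Real.pi * j / r * Complex.I)) ^ n * dftChar r j k /
        n.factorial * (s : ℂ) ^ n)
      (Complex.exp (2 * s * Complex.cosh (a + 2 * Real.pi * j / r * Complex.I)) *
        dftChar r j k) := fun j _ => by
    have := NormedSpace.expSeries_div_hasSum_exp (𝔸 := ℂ)
      (2 * s * Complex.cosh (a + 2 * Real.pi * j / r * Complex.I))
    rw [← Complex.exp_eq_exp_ℂ] at this
    refine hasSum_of_eq (fun n => ?_) (this.mul_right (dftChar r j k))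
    rw [mul_right_comm 2 (s : ℂ), mul_pow _ (s : ℂ)]
    ring
  refine hasSum_of_eq (fun n => ?_) ((hasSum_sum h).mul_left (r : ℂ)⁻¹)
  rw [tiltedCount, mul_div_assoc, mul_assoc, Finset.sum_div, Finset.sum_mul]

theorem hasSum_tilted_lineKernel {r : ℕ} (hr : 0 < r) (a : ℝ) {s : ℝ} (hs : 0 ≤ s) (k : ℤ) :
    HasSum (fun u : ℤ => Real.exp (a * (k + r * u : ℤ)) * lineKernel s (k + r * u))
      (tiltedPeriod r a s k).re := by
  have hc : ∀ n, HasSum (fun u : ℤ =>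
      Real.exp (a * (k + r * u : ℤ)) * lineCount n (k + r * u)) (tiltedCount r a n k).re :=
    fun n => by
      have := Complex.hasSum_re (hasSum_tilted_lineCount hr a (tiltedCount_zero hr a)
        (tiltedCount_succ r a) n k)
      simpa only [Complex.ofReal_re] using this
  have hn : HasSum (fun n : ℕ => (tiltedCount r a n k).re / n.factorial * s ^ n)
      (tiltedPeriod r a s k).re := by
    refine hasSum_of_eq (fun n => ?_) (Complex.hasSum_re (hasSum_tiltedCount r a s k))
    rw [← Complex.ofReal_pow, Complex.re_mul_ofReal, Complex.div_natCast_re]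
  have := hasSum_tsum_of_nonneg (f := fun n (u : ℤ) =>
    Real.exp (a * (k + r * u : ℤ)) * lineCount n (k + r * u) / n.factorial * s ^ n)
    (fun n u => by
      have := lineCount_nonneg n (k + r * u)
      positivity)
    (fun n => ((hc n).div_const _).mul_right _) hn
  refine hasSum_of_eq (fun u => ?_) this
  rw [lineKernel, ← tsum_mul_left]
  exact tsum_congr fun n => by ring

theorem hasSum_lineCount_period {r : ℕ} (hr : 0 < r) (n : ℕ) (k : ℤ) :
    HasSum (fun u : ℤ => lineCount n (k + r * u)) (lineCount n (k : ZMod r)) := by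
  have := Complex.hasSum_re (hasSum_tilted_lineCount hr 0
    (g := fun n k => ((lineCount n (k : ZMod r) : ℝ) : ℂ))
    (fun k => by
      simp only [lineCount, ZMod.intCast_zmod_eq_zero_iff_dvd]
      split_ifs <;> simp)
    (fun n k => by simp [lineCount]) n k)
  simpa using this

theorem hasSum_lineKernel_period {r : ℕ} (hr : 0 < r) {s : ℝ} (hs : 0 ≤ s) (k : ℤ) :
    HasSum (fun u : ℤ => lineKernel s (k + r * u)) (lineKernel s (k : ZMod r)) :=
  hasSum_tsum_of_nonneg (fun n u => by
      have := lineCount_nonneg n (k + r * u)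
      positivity)
    (fun n => ((hasSum_lineCount_period hr n k).div_const _).mul_right _)
    (summable_lineKernel hs _).hasSum

theorem lineKernel_zmod_eq {r : ℕ} (hr : 0 < r) {s : ℝ} (hs : 0 ≤ s) (k : ℤ) :
    lineKernel s (k : ZMod r) = (tiltedPeriod r 0 s k).re := by
  have := hasSum_tilted_lineKernel hr 0 hs k
  simp only [zero_mul, Real.exp_zero, one_mul] at this
  exact (hasSum_lineKernel_period hr hs k).unique this

/-- Tilting by `a` moves the frequency `θ` to `θ - ia`, and `Re cosh(a + iθ) = cosh a cos θ`. -/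
theorem norm_tiltedPeriod_term (r j : ℕ) (a s : ℝ) (k : ℤ) :
    ‖Complex.exp (2 * s * Complex.cosh (a + 2 * Real.pi * j / r * Complex.I)) * dftChar r j k‖ =
      Real.exp (2 * s * (Real.cosh a * Real.cos (2 * Real.pi * j / r))) := by
  have : (2 * s * Complex.cosh (a + 2 * Real.pi * j / r * Complex.I)).re =
      2 * s * (Real.cosh a * Real.cos (2 * Real.pi * j / r)) := by
    have h : (2 * Real.pi * j / r : ℂ) = ((2 * Real.pi * j / r : ℝ) : ℂ) := by push_cast; rfl
    rw [h, Complex.cosh_add, Complex.cosh_mul_I, Complex.sinh_mul_I, ← Complex.ofReal_cosh,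
      ← Complex.ofReal_sinh, ← Complex.ofReal_cos, ← Complex.ofReal_sin]
    generalize 2 * Real.pi * j / r = θ
    simp [-Complex.ofReal_cosh, -Complex.ofReal_sinh, -Complex.ofReal_cos, -Complex.ofReal_sin]
  rw [norm_mul, norm_dftChar, mul_one, Complex.norm_exp, this]

theorem re_tiltedPeriod_le {r : ℕ} (a s : ℝ) (k : ℤ) :
    (tiltedPeriod r a s k).re ≤ (r : ℝ)⁻¹ * ∑ j ∈ Finset.range r,
      Real.exp (2 * s * (Real.cosh a * Real.cos (2 * Real.pi * j / r))) := by
  refine (Complex.re_le_norm _).trans ?_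
  rw [tiltedPeriod, norm_mul, norm_inv, Complex.norm_natCast]
  refine mul_le_mul_of_nonneg_left ((norm_sum_le _ _).trans_eq ?_) (by positivity)
  exact Finset.sum_congr rfl fun j _ => norm_tiltedPeriod_term r j a s k

theorem abs_lineKernel_zmod_sub_le {r : ℕ} (hr : 0 < r) {s : ℝ} (hs : 0 ≤ s) (k : ℤ) :
    |lineKernel s (k : ZMod r) - (r : ℝ)⁻¹ * Real.exp (2 * s)| ≤
      (r : ℝ)⁻¹ * ∑ j ∈ Finset.Ico 1 r,
        Real.exp (2 * s * Real.cos (2 * Real.pi * j / r)) := by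
  have h : tiltedPeriod r 0 s k - ((r : ℝ)⁻¹ * Real.exp (2 * s) : ℝ) = (r : ℂ)⁻¹ *
      ∑ j ∈ Finset.Ico 1 r, Complex.exp (2 * s * Complex.cosh
        ((0 : ℝ) + 2 * Real.pi * j / r * Complex.I)) * dftChar r j k := by
    rw [tiltedPeriod, Finset.range_eq_Ico, Finset.sum_eq_sum_Ico_succ_bot hr]
    simp [dftChar, mul_add]
  rw [lineKernel_zmod_eq hr hs]
  have h2 : (tiltedPeriod r 0 s k).re - (r : ℝ)⁻¹ * Real.exp (2 * s) =
      (tiltedPeriod r 0 s k - ((r : ℝ)⁻¹ * Real.exp (2 * s) : ℝ)).re := by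
    rw [Complex.sub_re, Complex.ofReal_re]
  rw [h2, h]
  refine (Complex.abs_re_le_norm _).trans ?_
  rw [norm_mul, norm_inv, Complex.norm_natCast]
  refine mul_le_mul_of_nonneg_left ((norm_sum_le _ _).trans_eq ?_) (by positivity)
  exact Finset.sum_congr rfl fun j _ => by rw [norm_tiltedPeriod_term]; simp

/-! ### Decay of the nonzero Fourier modes. -/

theorem sum_exp_neg_mul_pow_le {c : ℝ} (hc : 0 < c) (n : ℕ) :
    ∑ j ∈ Finset.Ico 1 n, Real.exp (-c * j) ≤ 1 / c := by
  have hx1 : Real.exp (-c) < 1 := by simpa using hc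
  have h1 : ∑ j ∈ Finset.Ico 1 n, Real.exp (-c * j) ≤
      Real.exp (-c) ^ 1 / (1 - Real.exp (-c)) := by
    refine le_trans (Finset.sum_le_sum fun j _ => ?_)
      (geom_sum_Ico_le_of_lt_one (m := 1) (n := n) (Real.exp_pos _).le hx1)
    rw [← Real.exp_nat_mul, mul_comm]
  refine h1.trans ?_
  rw [pow_one, div_le_div_iff₀ (by linarith) hc]
  have h2 := Real.add_one_le_exp c
  have h3 : Real.exp (-c) * Real.exp c = 1 := by rw [← Real.exp_add]; simp
  nlinarith [Real.exp_pos (-c)]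

/-- The Gaussian decay of a mode is weakened to exponential decay so that the sum over modes becomes
geometric. The two terms account for the distance of `j` to either end, `0` or `r`. -/
theorem exp_cos_term_le {r j : ℕ} (hj : 1 ≤ j) (hjr : j < r) {s : ℝ} (hs : 0 < s) :
    Real.exp (-(2 * s * (1 - Real.cos (2 * Real.pi * j / r)))) ≤
      Real.exp 1 * (Real.exp (-(8 * √s / r) * j) + Real.exp (-(8 * √s / r) * (r - j : ℕ))) := by
  have hr : (0 : ℝ) < r := by exact_mod_cast (by omega : 0 < r)
  have key : ∀ m : ℕ, 2 * m ≤ r →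
      Real.cos (2 * Real.pi * m / r) = Real.cos (2 * Real.pi * j / r) →
      Real.exp (-(2 * s * (1 - Real.cos (2 * Real.pi * j / r)))) ≤
        Real.exp 1 * Real.exp (-(8 * √s / r) * m) := by
    intro m hm hcos
    have hm' : 2 * (m : ℝ) ≤ r := by exact_mod_cast hm
    have hsin : 2 * m / r ≤ Real.sin (Real.pi * m / r) := by
      have h := Real.mul_le_sin (x := Real.pi * m / r) (by positivity) (by
        rw [div_le_div_iff₀ hr two_pos]
        nlinarith [Real.pi_pos])
      refine le_trans (le_of_eq ?_) h
      field_simp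
    have hc : 1 - Real.cos (2 * Real.pi * m / r) = 2 * Real.sin (Real.pi * m / r) ^ 2 := by
      rw [show 2 * Real.pi * m / r = 2 * (Real.pi * m / r) by ring, Real.cos_two_mul,
        Real.cos_sq']
      ring
    rw [← hcos, hc, ← Real.exp_add, Real.exp_le_exp]
    have hsq : (2 * m / r : ℝ) ^ 2 ≤ Real.sin (Real.pi * m / r) ^ 2 :=
      pow_le_pow_left₀ (by positivity) hsin 2
    have hss : √s ^ 2 = s := Real.sq_sqrt hs.le
    have h1 : (4 * √s * m / r) ^ 2 ≤ 2 * s * (2 * Real.sin (Real.pi * m / r) ^ 2) := by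
      have : (4 * √s * m / r) ^ 2 = 4 * s * (2 * m / r) ^ 2 := by
        rw [show 4 * √s * m / r = √s * (4 * m / r) by ring, mul_pow, hss]
        ring
      rw [this]
      nlinarith
    have h2 : -(8 * √s / r) * m = -2 * (4 * √s * m / r) := by ring
    rw [h2]
    -- With `u = 4√s m / r` this is `-u² ≤ 1 - 2u`.
    nlinarith [sq_nonneg (4 * √s * m / r - 1)]
  rcases le_or_gt (2 * j) r with h | h
  · refine (key j h rfl).trans ?_
    gcongr
    linarith [Real.exp_pos (-(8 * √s / r) * (r - j : ℕ))]
  · refine (key (r - j) (by omega) ?_).trans ?_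
    · rw [Nat.cast_sub hjr.le, show 2 * Real.pi * ((r : ℝ) - j) / r =
        2 * Real.pi - 2 * Real.pi * j / r by field_simp, Real.cos_two_pi_sub]
    · gcongr
      linarith [Real.exp_pos (-(8 * √s / r) * j)]

theorem sum_exp_cos_le {r : ℕ} (hr : 0 < r) {s : ℝ} (hs : 0 < s) :
    ∑ j ∈ Finset.Ico 1 r, Real.exp (-(2 * s * (1 - Real.cos (2 * Real.pi * j / r)))) ≤
      r * (1 / √s) := by
  have hr' : (0 : ℝ) < r := by exact_mod_cast hr
  have hss : 0 < √s := Real.sqrt_pos.2 hs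
  have hc : 0 < 8 * √s / r := by positivity
  calc _ ≤ ∑ j ∈ Finset.Ico 1 r, Real.exp 1 * (Real.exp (-(8 * √s / r) * j) +
        Real.exp (-(8 * √s / r) * (r - j : ℕ))) := Finset.sum_le_sum fun j hj => by
          rw [Finset.mem_Ico] at hj
          exact exp_cos_term_le hj.1 hj.2 hs
    _ = Real.exp 1 * (∑ j ∈ Finset.Ico 1 r, Real.exp (-(8 * √s / r) * j) +
        ∑ j ∈ Finset.Ico 1 r, Real.exp (-(8 * √s / r) * j)) := by
          rw [← Finset.mul_sum, Finset.sum_add_distrib]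
          congr 2
          have := Finset.sum_Ico_reflect (fun j : ℕ => Real.exp (-(8 * √s / r) * j)) 1
            (m := r) (n := r) (by omega)
          rw [this]
          congr 2
          omega
    _ ≤ Real.exp 1 * (1 / (8 * √s / r) + 1 / (8 * √s / r)) := by
          gcongr <;> exact sum_exp_neg_mul_pow_le hc r
    _ = Real.exp 1 / 4 * (r * (1 / √s)) := by field_simp; ring
    _ ≤ 1 * (r * (1 / √s)) := by
          gcongr
          linarith [Real.exp_one_lt_d9]
    _ = _ := one_mul _

/-! ### Pointwise estimates for the one-dimensional heat kernels. -/

/-- The heat kernel of the one-dimensional continuous-time walk jumping at rate `1` in each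
direction. -/
def heatLine {R : Type} [Ring R] (s : ℝ) (x : R) : ℝ := Real.exp (-(2 * s)) * lineKernel s x

theorem heatLine_nonneg {R : Type} [Ring R] {s : ℝ} (hs : 0 ≤ s) (x : R) : 0 ≤ heatLine s x :=
  mul_nonneg (Real.exp_pos _).le (lineKernel_nonneg hs x)

theorem heatLine_le_zmod {r : ℕ} (hr : 0 < r) {s : ℝ} (hs : 0 ≤ s) (k : ℤ) :
    heatLine s k ≤ heatLine s (k : ZMod r) := by
  refine mul_le_mul_of_nonneg_left ?_ (Real.exp_pos _).le
  have := le_hasSum (hasSum_lineKernel_period hr hs k) 0 fun u _ => lineKernel_nonneg hs _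
  simpa using this

theorem abs_heatLine_zmod_sub_le {r : ℕ} (hr : 0 < r) {s : ℝ} (hs : 0 < s) (k : ℤ) :
    |heatLine s (k : ZMod r) - 1 / r| ≤
      (r : ℝ)⁻¹ * ∑ j ∈ Finset.Ico 1 r,
        Real.exp (-(2 * s * (1 - Real.cos (2 * Real.pi * j / r)))) := by
  have h := mul_le_mul_of_nonneg_left (abs_lineKernel_zmod_sub_le hr hs.le k)
    (Real.exp_pos (-(2 * s))).le
  rw [← abs_of_pos (Real.exp_pos (-(2 * s))), ← abs_mul, abs_of_pos (Real.exp_pos _)] at h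
  have h1 : Real.exp (-(2 * s)) * (lineKernel s (k : ZMod r) - (r : ℝ)⁻¹ * Real.exp (2 * s)) =
      heatLine s (k : ZMod r) - 1 / r := by
    rw [heatLine, mul_sub, mul_left_comm (Real.exp (-(2 * s))) (r : ℝ)⁻¹, ← Real.exp_add]
    simp
  rw [h1] at h
  refine h.trans_eq ?_
  rw [mul_left_comm, Finset.mul_sum]
  congr 1
  refine Finset.sum_congr rfl fun j _ => ?_
  rw [← Real.exp_add]
  ring_nf

theorem re_tiltedPeriod_le_min {r : ℕ} (hr : 0 < r) (a : ℝ) {s : ℝ} (hs : 0 < s) (k : ℤ) :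
    Real.exp (-(2 * s)) * (tiltedPeriod r a s k).re ≤
      Real.exp (2 * s * (Real.cosh a - 1)) * min 1 (1 / r + 1 / √s) := by
  have hr' : (0 : ℝ) < r := by exact_mod_cast hr
  have h1 : Real.exp (-(2 * s)) * (tiltedPeriod r a s k).re ≤
      Real.exp (2 * s * (Real.cosh a - 1)) * ((r : ℝ)⁻¹ * ∑ j ∈ Finset.range r,
        Real.exp (-(2 * s * (1 - Real.cos (2 * Real.pi * j / r))))) := by
    refine (mul_le_mul_of_nonneg_left (re_tiltedPeriod_le a s k) (Real.exp_pos _).le).trans ?_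
    rw [mul_left_comm, mul_left_comm (Real.exp (2 * s * (Real.cosh a - 1)))]
    refine mul_le_mul_of_nonneg_left ?_ (by positivity)
    rw [Finset.mul_sum, Finset.mul_sum]
    refine Finset.sum_le_sum fun j _ => ?_
    rw [← Real.exp_add, ← Real.exp_add, Real.exp_le_exp]
    have hc := Real.cos_le_one (2 * Real.pi * j / r)
    have hh := Real.one_le_cosh a
    -- Since `(cosh a - 1)(1 - cos θ) ≥ 0`, one has `cosh a cos θ - 1 ≤ (cosh a - 1) - (1 - cos θ)`:
    -- the cost of the tilt separates from the decay of the mode.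
    nlinarith [mul_nonneg hs.le (mul_nonneg (sub_nonneg.2 hc) (sub_nonneg.2 hh))]
  refine h1.trans (mul_le_mul_of_nonneg_left (le_min ?_ ?_) (Real.exp_pos _).le)
  · have : ∑ j ∈ Finset.range r, Real.exp (-(2 * s * (1 - Real.cos (2 * Real.pi * j / r)))) ≤
        ∑ j ∈ Finset.range r, (1 : ℝ) := Finset.sum_le_sum fun j _ => by
      rw [Real.exp_le_one_iff]
      have hc := Real.cos_le_one (2 * Real.pi * j / r)
      nlinarith
    rw [Finset.sum_const, Finset.card_range, nsmul_one] at this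
    calc _ ≤ (r : ℝ)⁻¹ * r := by gcongr
      _ = 1 := inv_mul_cancel₀ hr'.ne'
  · rw [Finset.range_eq_Ico, Finset.sum_eq_sum_Ico_succ_bot hr]
    have := sum_exp_cos_le hr hs
    calc _ ≤ (r : ℝ)⁻¹ * (1 + r * (1 / √s)) := by
          gcongr
          simp
      _ = _ := by field_simp

theorem heatLine_zmod_le_min {r : ℕ} (hr : 0 < r) {s : ℝ} (hs : 0 < s) (k : ℤ) :
    heatLine s (k : ZMod r) ≤ min 1 (1 / r + 1 / √s) := by
  have := re_tiltedPeriod_le_min hr 0 hs k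
  rw [heatLine, lineKernel_zmod_eq hr hs.le]
  simpa using this

/-- A Chernoff bound: every image `x = k + ru` with `u ≠ 0` has `|x| ≥ r/2`, so `e^{-ar/2}(e^{ax} +
e^{-ax}) ≥ 1` there, and the tilted sums are controlled by `re_tiltedPeriod_le_min`. -/
theorem heatLine_zmod_sub_le {r : ℕ} (hr : 0 < r) {a s : ℝ} (ha : 0 ≤ a) (hs : 0 < s) {k : ℤ}
    (hk1 : -(r : ℤ) ≤ 2 * k) (hk2 : 2 * k ≤ r) :
    heatLine s (k : ZMod r) - heatLine s k ≤ 2 * Real.exp (-(a * r / 2)) *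
      (Real.exp (2 * s * (Real.cosh a - 1)) * min 1 (1 / r + 1 / √s)) := by
  have hr' : (0 : ℝ) < r := by exact_mod_cast hr
  have hL := (hasSum_lineKernel_period hr hs.le k).sub (hasSum_ite_eq (0 : ℤ) (lineKernel s k))
  have hR := ((hasSum_tilted_lineKernel hr a hs.le k).add
    (hasSum_tilted_lineKernel hr (-a) hs.le k)).mul_left (Real.exp (-(a * r / 2)))
  have hle := hasSum_le (fun u => ?_) hL hR
  · have h1 := re_tiltedPeriod_le_min hr a hs k
    have h2 := re_tiltedPeriod_le_min hr (-a) hs k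
    rw [Real.cosh_neg] at h2
    have h3 := mul_le_mul_of_nonneg_left hle (Real.exp_pos (-(2 * s))).le
    rw [heatLine, heatLine, ← mul_sub]
    refine h3.trans ?_
    have h4 := mul_le_mul_of_nonneg_left (add_le_add h1 h2) (Real.exp_pos (-(a * r / 2))).le
    linarith
  · by_cases hu : u = 0
    · subst hu
      have := lineKernel_nonneg hs.le k
      simp only [mul_zero, add_zero, if_true, sub_self]
      positivity
    · have hK := lineKernel_nonneg hs.le (k + r * u)
      have hE : 1 ≤ Real.exp (-(a * r / 2)) * (Real.exp (a * (k + r * u : ℤ)) +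
          Real.exp (-a * (k + r * u : ℤ))) := by
        rw [mul_add, ← Real.exp_add, ← Real.exp_add]
        have hrz : (0 : ℤ) < r := by exact_mod_cast hr
        rcases lt_or_gt_of_ne hu with h | h
        · have hz : 2 * (k + r * u) ≤ -(r : ℤ) := by nlinarith
          have hzr : 2 * ((k + r * u : ℤ) : ℝ) ≤ -(r : ℝ) := by exact_mod_cast hz
          have : 0 ≤ -(a * r / 2) + -a * (k + r * u : ℤ) := by nlinarith
          linarith [Real.one_le_exp this, Real.exp_pos (-(a * r / 2) + a * (k + r * u : ℤ))]
        · have hz : (r : ℤ) ≤ 2 * (k + r * u) := by nlinarith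
          have hzr : (r : ℝ) ≤ 2 * ((k + r * u : ℤ) : ℝ) := by exact_mod_cast hz
          have : 0 ≤ -(a * r / 2) + a * (k + r * u : ℤ) := by nlinarith
          linarith [Real.one_le_exp this, Real.exp_pos (-(a * r / 2) + -a * (k + r * u : ℤ))]
      rw [if_neg hu, sub_zero, ← add_mul, ← mul_assoc]
      exact le_mul_of_one_le_left hK hE

theorem min_one_le_div_sqrt {r s : ℝ} (hr : 0 < r) (hs : 0 < s) (hsr : s ≤ r ^ 2) :
    min 1 (1 / r + 1 / √s) ≤ 3 / √(1 + s) := by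
  have hss : 0 < √s := Real.sqrt_pos.2 hs
  have h1 : √s ≤ r := by rw [← Real.sqrt_sq hr.le]; exact Real.sqrt_le_sqrt hsr
  have h2 : 1 / r ≤ 1 / √s := one_div_le_one_div_of_le hss h1
  rw [le_div_iff₀ (by positivity)]
  set m := min 1 (1 / r + 1 / √s) with hm
  have hm0 : 0 ≤ m := le_min zero_le_one (by positivity)
  have hm1 : m ≤ 1 := min_le_left _ _
  have hm2 : m * √s ≤ 2 := by
    have : m ≤ 2 / √s := (min_le_right _ _).trans (by
      rw [show 2 / √s = 1 / √s + 1 / √s by ring]; linarith)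
    rwa [le_div_iff₀ hss] at this
  have h3 : √(1 + s) ≤ 1 + √s := by
    rw [Real.sqrt_le_left (by positivity)]
    nlinarith [Real.sq_sqrt hs.le]
  nlinarith

theorem heatLine_zmod_sub_le_of_le_sq {r : ℕ} (hr : 0 < r) {s : ℝ} (hs : 0 < s)
    (hsr : s ≤ (r : ℝ) ^ 2) {k : ℤ} (hk1 : -(r : ℤ) ≤ 2 * k) (hk2 : 2 * k ≤ r) :
    heatLine s (k : ZMod r) - heatLine s k ≤
      6 * Real.exp 2 / √(1 + s) * Real.exp (-(r / √(1 + s) / 2)) := by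
  have hr' : (0 : ℝ) < r := by exact_mod_cast hr
  have hσ : 0 < √(1 + s) := by positivity
  -- The diffusive scale keeps `s a² ≤ 1`, so the tilt costs at most `e²`; using `1 + s` keeps `a ≤
  -- 1` as `s → 0`.
  set a := 1 / √(1 + s) with ha
  have ha0 : 0 < a := by positivity
  have hasq : a ^ 2 * (1 + s) = 1 := by
    rw [ha, div_pow, Real.sq_sqrt (by positivity)]; field_simp
  have hcosh : Real.cosh a - 1 ≤ a ^ 2 := by
    have h1 := Real.cosh_le_exp_half_sq a
    have h2 := Real.abs_exp_sub_one_le (x := a ^ 2 / 2) (by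
      rw [abs_of_nonneg (by positivity)]; nlinarith [mul_pos (pow_pos ha0 2) hs])
    rw [abs_of_nonneg (by positivity : 0 ≤ a ^ 2 / 2)] at h2
    linarith [le_abs_self (Real.exp (a ^ 2 / 2) - 1)]
  have hexp : Real.exp (2 * s * (Real.cosh a - 1)) ≤ Real.exp 2 := by
    rw [Real.exp_le_exp]
    nlinarith [sq_nonneg a]
  calc _ ≤ 2 * Real.exp (-(a * r / 2)) *
      (Real.exp (2 * s * (Real.cosh a - 1)) * min 1 (1 / r + 1 / √s)) :=
        heatLine_zmod_sub_le hr ha0.le hs hk1 hk2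
    _ ≤ 2 * Real.exp (-(a * r / 2)) * (Real.exp 2 * (3 / √(1 + s))) := by
        gcongr
        exact min_one_le_div_sqrt hr' hs hsr
    _ = _ := by
        rw [ha, show 1 / √(1 + s) * r / 2 = r / √(1 + s) / 2 by ring]
        ring

/-! ### Comparing products of heat kernels. -/

/-- Factors are exchanged one at a time, each exchange costing a relative error `ε`. -/
theorem prod_add_sub_prod_le {ι : Type*} (t : Finset ι) {Q q : ι → ℝ} {B ε : ℝ} (hB : 0 ≤ B)
    (hε : 0 ≤ ε) (hq : ∀ i, 0 ≤ q i) (hqQ : ∀ i, q i ≤ Q i) (hQ : ∀ i, Q i ≤ B)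
    (hE : ∀ i, Q i - q i ≤ B * ε) :
    ∏ i ∈ t, Q i - ∏ i ∈ t, q i ≤ (2 * B) ^ t.card * ε := by
  classical
  have key : ∏ i ∈ t, Q i - ∏ i ∈ t, q i ≤ B ^ t.card * (2 ^ t.card - 1) * ε := by
    induction t using Finset.induction_on with
    | empty => simp
    | insert a t ha ih =>
      rw [Finset.prod_insert ha, Finset.prod_insert ha, Finset.card_insert_of_notMem ha]
      have h1 : ∏ i ∈ t, q i ≤ B ^ t.card := by
        rw [← Finset.prod_const]
        exact Finset.prod_le_prod (fun i _ => hq i) fun i _ => (hqQ i).trans (hQ i)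
      have h0 : 0 ≤ ∏ i ∈ t, q i := Finset.prod_nonneg fun i _ => hq i
      have hd : 0 ≤ ∏ i ∈ t, Q i - ∏ i ∈ t, q i :=
        sub_nonneg.2 (Finset.prod_le_prod (fun i _ => hq i) fun i _ => hqQ i)
      have h3 : 0 ≤ B ^ t.card * (2 ^ t.card - 1) * ε := hd.trans ih
      calc Q a * ∏ i ∈ t, Q i - q a * ∏ i ∈ t, q i
          = Q a * (∏ i ∈ t, Q i - ∏ i ∈ t, q i) + (Q a - q a) * ∏ i ∈ t, q i := by ring
        _ ≤ B * (B ^ t.card * (2 ^ t.card - 1) * ε) + B * ε * B ^ t.card := by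
            refine add_le_add (mul_le_mul (hQ a) ih hd hB)
              (mul_le_mul (hE a) h1 h0 (by positivity))
        _ ≤ _ := by
            rw [pow_succ, pow_succ]
            have : 0 ≤ B ^ t.card * B * ε := by positivity
            nlinarith
  refine key.trans ?_
  rw [mul_pow]
  have : 0 ≤ B ^ t.card * ε := by positivity
  nlinarith

theorem prod_heatLine_sub_le {d : ℕ} : ∃ c > (0 : ℝ), ∀ r : ℕ, 0 < r → ∀ s : ℝ, 0 < s →
    ∀ k : Fin d → ℤ, (∀ j, -(r : ℤ) ≤ 2 * k j ∧ 2 * k j ≤ r) →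
      ∏ j, heatLine s (k j : ZMod r) - ∏ j, heatLine s (k j) ≤ c / (r : ℝ) ^ d := by
  refine ⟨max (2 ^ d) ((12 * Real.exp 2) ^ d * (2 ^ d * d.factorial)), by positivity,
    fun r hr s hs k hk => ?_⟩
  have hr' : (0 : ℝ) < r := by exact_mod_cast hr
  rcases le_or_gt s ((r : ℝ) ^ 2) with hsr | hsr
  · have hσ : 0 < √(1 + s) := by positivity
    have h := prod_add_sub_prod_le (Finset.univ : Finset (Fin d))
      (Q := fun j => heatLine s (k j : ZMod r)) (q := fun j => heatLine s (k j))
      (B := 6 * Real.exp 2 / √(1 + s)) (ε := Real.exp (-(r / √(1 + s) / 2)))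
      (by positivity) (by positivity)
      (fun j => heatLine_nonneg hs.le _) (fun j => heatLine_le_zmod hr hs.le _)
      (fun j => (heatLine_zmod_le_min hr hs _).trans
        ((min_one_le_div_sqrt hr' hs hsr).trans (by
          gcongr
          linarith [Real.add_one_le_exp 2])))
      (fun j => heatLine_zmod_sub_le_of_le_sq hr hs hsr (hk j).1 (hk j).2)
    refine h.trans ?_
    rw [Finset.card_univ, Fintype.card_fin]
    set v := r / √(1 + s) / 2 with hv
    have hv0 : 0 < v := by positivity
    -- The power `v^{-d}`, of order `((1+s)^{1/2}/r)^d`, cancels the prefactor `(1+s)^{-d/2}` and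
    -- leaves `r^{-d}` uniformly in `s`.
    have hexp : Real.exp (-v) ≤ d.factorial / v ^ d := by
      rw [Real.exp_neg, inv_le_comm₀ (Real.exp_pos _) (by positivity), inv_div]
      exact Real.pow_div_factorial_le_exp v hv0.le d
    calc (2 * (6 * Real.exp 2 / √(1 + s))) ^ d * Real.exp (-v)
        ≤ (2 * (6 * Real.exp 2 / √(1 + s))) ^ d * (d.factorial / v ^ d) := by gcongr
      _ = (12 * Real.exp 2) ^ d * (2 ^ d * d.factorial) / r ^ d := by
          rw [hv, show 2 * (6 * Real.exp 2 / √(1 + s)) = 12 * Real.exp 2 / √(1 + s) by ring,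
            div_pow, div_pow, div_pow]
          field_simp
      _ ≤ _ := by
          gcongr
          exact le_max_right _ _
  · have hQ : ∀ j, heatLine s (k j : ZMod r) ≤ 2 / r := fun j => by
      refine (heatLine_zmod_le_min hr hs _).trans ((min_le_right _ _).trans ?_)
      have h1 : (r : ℝ) ≤ √s := Real.le_sqrt_of_sq_le hsr.le
      have h2 : 1 / √s ≤ 1 / r := one_div_le_one_div_of_le hr' h1
      rw [show (2 : ℝ) / r = 1 / r + 1 / r by ring]
      linarith
    have h1 : ∏ j, heatLine s (k j : ZMod r) ≤ ∏ j : Fin d, (2 / r : ℝ) :=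
      Finset.prod_le_prod (fun j _ => heatLine_nonneg hs.le _) fun j _ => hQ j
    have h0 : 0 ≤ ∏ j, heatLine s (k j) := Finset.prod_nonneg fun j _ => heatLine_nonneg hs.le _
    rw [Finset.prod_const, Finset.card_univ, Fintype.card_fin, div_pow] at h1
    refine (sub_le_self _ h0).trans (h1.trans ?_)
    gcongr
    exact le_max_left _ _

/-- The lattice kernel is dominated by the torus kernel of any period, so a period larger than `√s`
transfers the torus bound. -/
theorem heatLine_le {s : ℝ} (hs : 0 < s) (k : ℤ) : heatLine s k ≤ 2 / √s := by
  have hss : 0 < √s := Real.sqrt_pos.2 hs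
  obtain ⟨r, hr⟩ := exists_nat_gt √s
  have hr0 : 0 < r := by exact_mod_cast hss.trans hr
  refine (heatLine_le_zmod hr0 hs.le k).trans ((heatLine_zmod_le_min hr0 hs k).trans
    ((min_le_right _ _).trans ?_))
  have := one_div_le_one_div_of_le hss hr.le
  rw [show 2 / √s = 1 / √s + 1 / √s by ring]
  linarith

/-- For `√s ≥ 16r` the zero mode `1/r` dominates: torus factors are at least `1/(2r)`, lattice
factors at most `1/(4r)`, and `2^d - 1 ≥ 1`. -/
theorem le_prod_heatLine_sub {d r : ℕ} (hd : d ≠ 0) (hr : 0 < r) {s : ℝ}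
    (hs : 256 * (r : ℝ) ^ 2 ≤ s) (k : Fin d → ℤ) :
    (1 / (4 * r)) ^ d ≤ ∏ j, heatLine s (k j : ZMod r) - ∏ j, heatLine s (k j) := by
  have hr' : (0 : ℝ) < r := by exact_mod_cast hr
  have hs0 : 0 < s := lt_of_lt_of_le (by positivity) hs
  have hss : 16 * r ≤ √s := Real.le_sqrt_of_sq_le (by linarith)
  have hq : ∀ j, heatLine s (k j) ≤ 1 / (4 * r) := fun j => by
    refine (heatLine_le hs0 _).trans ?_
    rw [div_le_div_iff₀ (by linarith) (by positivity)]
    linarith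
  have hQ : ∀ j, 1 / (2 * r) ≤ heatLine s (k j : ZMod r) := fun j => by
    have h1 := abs_heatLine_zmod_sub_le hr hs0 (k j)
    have h2 : (r : ℝ)⁻¹ * ∑ j ∈ Finset.Ico 1 r,
        Real.exp (-(2 * s * (1 - Real.cos (2 * Real.pi * j / r)))) ≤ 1 / (2 * r) := by
      calc _ ≤ (r : ℝ)⁻¹ * (r * (1 / √s)) := by gcongr; exact sum_exp_cos_le hr hs0
        _ = 1 / √s := by field_simp
        _ ≤ _ := one_div_le_one_div_of_le (by positivity) (by linarith)
    have h3 := (abs_le.1 (h1.trans h2)).1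
    have h4 : (1 : ℝ) / r = 1 / (2 * r) + 1 / (2 * r) := by field_simp; norm_num
    linarith
  have h1 : ∏ j, heatLine s (k j) ≤ (1 / (4 * r) : ℝ) ^ d := by
    have := Finset.prod_le_prod (s := Finset.univ)
      (fun j _ => heatLine_nonneg hs0.le (k j)) fun j _ => hq j
    simpa only [Finset.prod_const, Finset.card_univ, Fintype.card_fin] using this
  have h2 : (1 / (2 * r) : ℝ) ^ d ≤ ∏ j, heatLine s (k j : ZMod r) := by
    have := Finset.prod_le_prod (s := Finset.univ)
      (fun j _ => (by positivity : (0 : ℝ) ≤ 1 / (2 * r))) fun j _ => hQ j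
    simpa only [Finset.prod_const, Finset.card_univ, Fintype.card_fin] using this
  have h3 : (1 / (2 * r) : ℝ) ^ d = 2 ^ d * (1 / (4 * r)) ^ d := by
    rw [← mul_pow]; congr 1; field_simp; norm_num
  have h4 : (2 : ℝ) ≤ 2 ^ d := le_self_pow₀ (by norm_num) hd
  have h5 : (0 : ℝ) ≤ (1 / (4 * r)) ^ d := by positivity
  nlinarith

theorem heatLine_le_one {R : Type} [Ring R] {s : ℝ} (hs : 0 ≤ s) (x : R) : heatLine s x ≤ 1 := by
  have h1 : lineKernel s x ≤ Real.exp (2 * s) := by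
    have h := NormedSpace.expSeries_div_hasSum_exp (𝔸 := ℝ) (2 * s)
    rw [← Real.exp_eq_exp_ℝ] at h
    refine hasSum_le (fun n => ?_) (summable_lineKernel hs x).hasSum h
    rw [mul_pow, mul_div_right_comm]
    have := lineCount_le n x
    gcongr
  calc heatLine s x ≤ Real.exp (-(2 * s)) * Real.exp (2 * s) :=
        mul_le_mul_of_nonneg_left h1 (Real.exp_pos _).le
    _ = 1 := by rw [← Real.exp_add]; simp

/-! ### Integral representation of the Green functions. -/

open MeasureTheory Set

theorem integrableOn_exp_neg_mul_pow (n : ℕ) :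
    IntegrableOn (fun t : ℝ => Real.exp (-t) * t ^ n) (Ioi 0) := by
  have h := Real.GammaIntegral_convergent (s := n + 1) (by positivity)
  simpa using h

theorem integral_exp_neg_mul_pow (n : ℕ) :
    ∫ t in Ioi (0 : ℝ), Real.exp (-t) * t ^ n = n.factorial := by
  have h := Real.Gamma_eq_integral (s := n + 1) (by positivity)
  rw [Real.Gamma_nat_eq_factorial] at h
  simpa using h.symm

theorem one_sub_two_mul_pos {d : ℕ} {z : ℝ} (hz' : z < srwCritical d) :
    0 < 1 - 2 * (d : ℝ) * z := by
  rcases Nat.eq_zero_or_pos d with rfl | hd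
  · simp
  · have : (0 : ℝ) < 2 * d := by positivity
    rw [srwCritical, lt_div_iff₀ this] at hz'
    linarith

theorem exp_mul_prod_heatLine {d : ℕ} {R : Type} [Ring R] (z t : ℝ) (y : Fin d → R) :
    Real.exp (-(1 - 2 * d * z) * t) * ∏ j, heatLine (z * t) (y j) =
      Real.exp (-t) * ∏ j, lineKernel (z * t) (y j) := by
  simp only [heatLine]
  rw [Finset.prod_mul_distrib, Finset.prod_const, Finset.card_univ, Fintype.card_fin,
    ← Real.exp_nat_mul, ← mul_assoc, ← Real.exp_add]
  ring_nf

/-- Gamma integrals are inserted termwise and summed under the integral. Normalising `d` line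
kernels absorbs `e^{-2dzt}`, leaving the mass term `e^{-(1-2dz)t}`. -/
theorem srwTwoPoint_eq_integral {d : ℕ} {R : Type} [Ring R] (h2 : (1 : R) ≠ -1) {z : ℝ}
    (hz : 0 ≤ z) (hz' : z < srwCritical d) (y : Fin d → R) :
    IntegrableOn (fun t => Real.exp (-(1 - 2 * d * z) * t) * ∏ j, heatLine (z * t) (y j))
        (Ioi 0) ∧
      srwTwoPoint z y =
        ∫ t in Ioi 0, Real.exp (-(1 - 2 * d * z) * t) * ∏ j, heatLine (z * t) (y j) := by
  set g := fun t => Real.exp (-(1 - 2 * d * z) * t) * ∏ j, heatLine (z * t) (y j) with hg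
  set F : ℕ → ℝ → ℝ := fun n t =>
    ((srwWalks n y).ncard : ℝ) / n.factorial * z ^ n * (Real.exp (-t) * t ^ n) with hF
  have hsum : ∀ t ∈ Ioi (0 : ℝ), HasSum (fun n => F n t) (g t) := fun t ht => by
    simp only [hg]
    rw [exp_mul_prod_heatLine]
    refine hasSum_of_eq (fun n => ?_) ((hasSum_ncard_srwWalks_div_factorial h2
      (mul_nonneg hz (le_of_lt ht)) y).mul_left (Real.exp (-t)))
    simp only [hF]
    ring
  have hFint : ∀ n, IntegrableOn (F n) (Ioi 0) := fun n =>
    (integrableOn_exp_neg_mul_pow n).const_mul _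
  have hFval : ∀ n, ∫ t in Ioi 0, F n t = ((srwWalks n y).ncard : ℝ) * z ^ n := fun n => by
    simp only [hF]
    rw [integral_const_mul, integral_exp_neg_mul_pow]
    have : (n.factorial : ℝ) ≠ 0 := by positivity
    field_simp
  have hFnorm : ∀ n, ∫ t in Ioi 0, ‖F n t‖ = ((srwWalks n y).ncard : ℝ) * z ^ n := fun n => by
    rw [← hFval]
    refine setIntegral_congr_fun measurableSet_Ioi fun t ht => ?_
    have ht' : (0 : ℝ) < t := ht
    exact Real.norm_of_nonneg (by positivity)
  have hmeas : AEStronglyMeasurable g (volume.restrict (Ioi 0)) := by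
    refine aestronglyMeasurable_of_tendsto_ae Filter.atTop
      (f := fun N t => ∑ n ∈ Finset.range N, F n t) (fun N => ?_) ?_
    · exact (integrable_finsetSum _ fun n _ => hFint n).aestronglyMeasurable
    · filter_upwards [ae_restrict_mem measurableSet_Ioi] with t ht
      exact (hsum t ht).tendsto_sum_nat
  refine ⟨?_, ?_⟩
  · refine (integrableOn_exp_mul_Ioi (neg_neg_of_pos (one_sub_two_mul_pos hz')) 0).mono' hmeas ?_
    filter_upwards [ae_restrict_mem measurableSet_Ioi] with t ht
    have hzt : 0 ≤ z * t := mul_nonneg hz (le_of_lt ht)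
    have hp0 : 0 ≤ ∏ j, heatLine (z * t) (y j) :=
      Finset.prod_nonneg fun j _ => heatLine_nonneg hzt _
    have hp1 : ∏ j, heatLine (z * t) (y j) ≤ 1 :=
      Finset.prod_le_one (fun j _ => heatLine_nonneg hzt _) fun j _ => heatLine_le_one hzt _
    rw [Real.norm_of_nonneg (mul_nonneg (Real.exp_pos _).le hp0)]
    exact mul_le_of_le_one_right (Real.exp_pos _).le hp1
  · have h := hasSum_integral_of_summable_integral_norm hFint (by
      simp only [hFnorm]
      exact summable_srwTwoPoint hz hz' y)
    simp only [hFval] at h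
    rw [srwTwoPoint, h.tsum_eq]
    exact setIntegral_congr_fun measurableSet_Ioi fun t ht => (hsum t ht).tsum_eq

theorem torusGreen_sub_latticeGreen_eq_integral {d r : ℕ} (hr : 3 ≤ r) {z : ℝ} (hz : 0 ≤ z)
    (hz' : z < srwCritical d) (k : Fin d → ℤ) :
    IntegrableOn (fun t => Real.exp (-(1 - 2 * d * z) * t) *
        (∏ j, heatLine (z * t) (k j : ZMod r) - ∏ j, heatLine (z * t) (k j))) (Ioi 0) ∧
      torusGreen d r z (fun j => (k j : ZMod r)) - latticeGreen d z k =
        ∫ t in Ioi 0, Real.exp (-(1 - 2 * d * z) * t) *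
          (∏ j, heatLine (z * t) (k j : ZMod r) - ∏ j, heatLine (z * t) (k j)) := by
  have h2 : (1 : ZMod r) ≠ -1 := by
    have : Fact (2 < r) := ⟨hr⟩
    exact (ZMod.neg_one_ne_one).symm
  have h1 := srwTwoPoint_eq_integral h2 hz hz' fun j => (k j : ZMod r)
  have h3 := srwTwoPoint_eq_integral (R := ℤ) (by norm_num) hz hz' k
  simp only [mul_sub]
  refine ⟨h1.1.sub h3.1, ?_⟩
  rw [torusGreen, latticeGreen, h1.2, h3.2, integral_sub h1.1 h3.1]

/-! ### Upper and lower bounds for the torus Green function. -/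

theorem torusGreen_le {d : ℕ} : ∃ c > (0 : ℝ), ∀ r : ℕ, 3 ≤ r → ∀ x : Fin d → ZMod r,
    ∀ z ∈ Ioo 0 (srwCritical d), torusGreen d r z x ≤
      latticeGreen d z (torusRep x) + c * (srwSusceptibility d z / (r : ℝ) ^ d) := by
  obtain ⟨c, hc, h⟩ := prod_heatLine_sub_le (d := d)
  refine ⟨c, hc, fun r hr x z hz => ?_⟩
  have hr0 : 0 < r := by omega
  have hμ := one_sub_two_mul_pos hz.2
  have hx : x = fun j => ((torusRep x j : ℤ) : ZMod r) :=
    funext fun j => (torusRep_spec hr0 x j).1.symm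
  have hI := torusGreen_sub_latticeGreen_eq_integral hr hz.1.le hz.2 (torusRep x)
  rw [← hx] at hI
  rw [← sub_le_iff_le_add', hI.2, srwSusceptibility_eq hz.1.le hz.2]
  have hexp := integrableOn_exp_mul_Ioi (neg_neg_of_pos hμ) 0
  calc _ ≤ ∫ t in Ioi (0 : ℝ), Real.exp (-(1 - 2 * d * z) * t) * (c / (r : ℝ) ^ d) := by
        refine setIntegral_mono_on hI.1 (hexp.mul_const _) measurableSet_Ioi fun t ht => ?_
        refine mul_le_mul_of_nonneg_left (h r hr0 _ (mul_pos hz.1 ht) _ fun j => ?_)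
          (Real.exp_pos _).le
        have := torusRep_spec hr0 x j
        exact ⟨this.2.1, this.2.2.le⟩
    _ = _ := by
        rw [integral_mul_const, integral_exp_mul_Ioi (neg_neg_of_pos hμ), neg_div_neg_eq, mul_zero,
          Real.exp_zero]
        ring

theorem le_torusGreen {d r : ℕ} (hd : d ≠ 0) (hr : 3 ≤ r) (x : Fin d → ZMod r) {z : ℝ}
    (hz : srwCritical d - 1 / (2048 * (d : ℝ) ^ 2) / (r : ℝ) ^ 2 ≤ z) (hz' : z < srwCritical d) :
    latticeGreen d z (torusRep x) +
        Real.exp (-1) / 4 ^ d * (srwSusceptibility d z / (r : ℝ) ^ d) ≤ torusGreen d r z x := by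
  have hr0 : 0 < r := by omega
  have hd1 : (1 : ℝ) ≤ d := by exact_mod_cast Nat.one_le_iff_ne_zero.2 hd
  have hr3 : (3 : ℝ) ≤ r := by exact_mod_cast hr
  have hd0 : (0 : ℝ) < d := by linarith
  have hrp : (0 : ℝ) < r := by linarith
  have hcrit : srwCritical d = 1 / (2 * d) := rfl
  have hz4 : 1 / (4 * d) ≤ z := by
    have h1 : 1 / (2048 * (d : ℝ) ^ 2) / (r : ℝ) ^ 2 ≤ 1 / (4 * d) := by
      rw [div_div]
      refine one_div_le_one_div_of_le (by positivity) ?_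
      nlinarith [mul_le_mul hd1 hd1 zero_le_one hd0.le, mul_pos hd0 hd0,
        mul_nonneg (mul_pos hd0 hd0).le (by nlinarith : (0 : ℝ) ≤ (r : ℝ) ^ 2 - 1)]
    have h2 : (1 : ℝ) / (2 * d) = 1 / (4 * d) + 1 / (4 * d) := by field_simp; norm_num
    rw [hcrit] at hz
    linarith
  have hz0 : 0 < z := lt_of_lt_of_le (by positivity) hz4
  have hμ := one_sub_two_mul_pos hz'
  have hx : x = fun j => ((torusRep x j : ℤ) : ZMod r) :=
    funext fun j => (torusRep_spec hr0 x j).1.symm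
  have hI := torusGreen_sub_latticeGreen_eq_integral hr hz0.le hz' (torusRep x)
  rw [← hx] at hI
  rw [← le_sub_iff_add_le', hI.2, srwSusceptibility_eq hz0.le hz']
  -- With `z ≥ 1/(4d)`, times `t > T` satisfy `zt ≥ 256 r²`; the window constant `1/(2048 d²)` is
  -- chosen so that `(1 - 2dz)T ≤ 1`, whence the factor `e^{-1}`.
  set T : ℝ := 1024 * d * (r : ℝ) ^ 2 with hT
  have hT0 : 0 ≤ T := by positivity
  have hexp := integrableOn_exp_mul_Ioi (neg_neg_of_pos hμ) T
  have hμT : (1 - 2 * d * z) * T ≤ 1 := by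
    have h1 : 1 - 2 * d * z ≤ 1 / (1024 * d * (r : ℝ) ^ 2) := by
      have h3 : 2 * d * (srwCritical d - 1 / (2048 * (d : ℝ) ^ 2) / (r : ℝ) ^ 2) ≤ 2 * d * z := by
        gcongr
      have h4 : 2 * d * (srwCritical d - 1 / (2048 * (d : ℝ) ^ 2) / (r : ℝ) ^ 2) =
          1 - 1 / (1024 * d * (r : ℝ) ^ 2) := by
        rw [hcrit]; field_simp; ring
      linarith
    rw [← hT] at h1
    exact (le_div_iff₀ (by positivity)).1 h1
  calc Real.exp (-1) / 4 ^ d * (1 / (1 - 2 * d * z) / (r : ℝ) ^ d)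
      ≤ Real.exp (-((1 - 2 * d * z) * T)) / 4 ^ d * (1 / (1 - 2 * d * z) / (r : ℝ) ^ d) := by
        gcongr
    _ = ∫ t in Ioi T, Real.exp (-(1 - 2 * d * z) * t) * (1 / (4 * r)) ^ d := by
        rw [integral_mul_const, integral_exp_mul_Ioi (neg_neg_of_pos hμ), neg_mul, neg_div_neg_eq,
          div_pow, one_pow, mul_pow]
        field_simp
    _ ≤ ∫ t in Ioi T, Real.exp (-(1 - 2 * d * z) * t) *
        (∏ j, heatLine (z * t) (torusRep x j : ZMod r) - ∏ j, heatLine (z * t) (torusRep x j)) := by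
        refine setIntegral_mono_on (hexp.mul_const _)
          (hI.1.mono_set (Ioi_subset_Ioi hT0)) measurableSet_Ioi fun t ht => ?_
        refine mul_le_mul_of_nonneg_left (le_prod_heatLine_sub hd hr0 ?_ _) (Real.exp_pos _).le
        calc 256 * (r : ℝ) ^ 2 = 1 / (4 * d) * T := by rw [hT]; field_simp; norm_num
          _ ≤ z * t := mul_le_mul hz4 (le_of_lt ht) hT0 hz0.le
    -- Times up to `T` can be dropped because the torus kernel dominates the lattice kernel at every
    -- time.
    _ ≤ _ := by
        refine setIntegral_mono_set hI.1 ?_ (Ioi_subset_Ioi hT0).eventuallyLE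
        filter_upwards [ae_restrict_mem measurableSet_Ioi] with t ht
        have hzt : 0 ≤ z * t := mul_nonneg hz0.le (le_of_lt ht)
        exact mul_nonneg (Real.exp_pos _).le (sub_nonneg.2 (Finset.prod_le_prod
          (fun j _ => heatLine_nonneg hzt _) fun j _ => heatLine_le_zmod hr0 hzt _))

end

theorem theorem1p4 (d : ℕ) (hd : 2 < d) :
    (d ≠ 4 →
      ∃ c₁ > (0 : ℝ), ∃ c₂ > (0 : ℝ), ∃ c₃ > (0 : ℝ),
        ∀ r : ℕ, 3 ≤ r → ∀ x : Fin d → ZMod r,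
          (∀ z ∈ Set.Ioo 0 (srwCritical d),
            torusGreen d r z x ≤
              latticeGreen d z (torusRep x) + c₂ * (srwSusceptibility d z / (r : ℝ) ^ d)) ∧
          (∀ z ∈ Set.Ico (srwCritical d - c₃ / (r : ℝ) ^ 2) (srwCritical d),
            latticeGreen d z (torusRep x) + c₁ * (srwSusceptibility d z / (r : ℝ) ^ d) ≤
              torusGreen d r z x)) ∧
    (d = 4 →
      ∃ c₁ > (0 : ℝ), ∃ c₂ > (0 : ℝ), ∃ ε > (0 : ℝ),
        ∀ r : ℕ, 3 ≤ r → ∀ x : Fin d → ZMod r, ∀ z ∈ Set.Ioo 0 (srwCritical d),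
          torusGreen d r z x ≤
              latticeGreen d z (torusRep x) + c₂ * (srwSusceptibility d z / (r : ℝ) ^ d) ∧
          ((srwCritical d - z) * |Real.log (srwCritical d - z)| * (r : ℝ) ^ 2 ≤ ε →
            latticeGreen d z (torusRep x) +
                c₁ * (srwSusceptibility d z / (r : ℝ) ^ d) *
                  (1 / Real.log (srwSusceptibility d z)) ≤
              torusGreen d r z x)) := by
  have hd0 : d ≠ 0 := by omega
  have hdp : (0 : ℝ) < d := by positivity
  obtain ⟨c₂, hc₂, hupper⟩ := torusGreen_le (d := d)
  have hc₁ : 0 < Real.exp (-1) / 4 ^ d := by positivity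
  have hc₃ : 0 < 1 / (2048 * (d : ℝ) ^ 2) := by positivity
  refine ⟨fun _ => ⟨_, hc₁, c₂, hc₂, _, hc₃, fun r hr x => ⟨hupper r hr x, fun z hz =>
    le_torusGreen hd0 hr x hz.1 hz.2⟩⟩, fun h4 => ⟨_, hc₁, c₂, hc₂, _, hc₃,
    fun r hr x z hz => ⟨hupper r hr x z hz, fun hρ => ?_⟩⟩⟩
  have hcrit : srwCritical d = 1 / 8 := by rw [srwCritical, h4]; norm_num
  have hr3 : (3 : ℝ) ≤ r := by exact_mod_cast hr
  set ρ := srwCritical d - z with hρdef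
  have hρ0 : 0 < ρ := sub_pos.2 hz.2
  have hρ8 : ρ ≤ 1 / 8 := by rw [hρdef, hcrit]; linarith [hz.1]
  -- Since `ρ ≤ 1/8 < e^{-1}`, the logarithmic window lies inside the window `ρ r² ≤ 1/(2048 d²)`.
  have hlog : 1 ≤ |Real.log ρ| := by
    have h1 : Real.log ρ ≤ -1 := by
      rw [Real.log_le_iff_le_exp hρ0, Real.exp_neg]
      refine hρ8.trans ?_
      rw [one_div]
      exact inv_anti₀ (Real.exp_pos _) (by linarith [Real.exp_one_lt_d9])
    rw [abs_of_neg (by linarith)]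
    linarith
  have hρr : ρ * (r : ℝ) ^ 2 ≤ 1 / (2048 * (d : ℝ) ^ 2) := by
    refine le_trans ?_ hρ
    gcongr
    exact le_mul_of_one_le_right hρ0.le hlog
  have hzle : srwCritical d - 1 / (2048 * (d : ℝ) ^ 2) / (r : ℝ) ^ 2 ≤ z := by
    have := (le_div_iff₀ (by positivity)).2 hρr
    linarith
  have hχ : srwSusceptibility d z = 1 / (8 * ρ) := by
    rw [srwSusceptibility_eq hz.1.le hz.2, hρdef, hcrit, h4]
    congr 1
    push_cast
    ring
  -- The window forces `ρ ≤ 1/32`, so `χ₀ = 1/(8ρ) ≥ 4 > e` and dividing by `log χ₀` only weakens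
  -- the bound.
  have hlogχ : 1 ≤ Real.log (srwSusceptibility d z) := by
    rw [hχ, Real.le_log_iff_exp_le (by positivity)]
    have h1 : ρ ≤ 1 / 32 := by
      have h2 : (1 : ℝ) / (2048 * (d : ℝ) ^ 2) ≤ 1 / 32 := by rw [h4]; norm_num
      nlinarith
    rw [le_div_iff₀ (by positivity)]
    nlinarith [Real.exp_one_lt_d9, Real.exp_pos 1]
  refine le_trans ?_ (le_torusGreen hd0 hr x hzle hz.2)
  refine add_le_add le_rfl (mul_le_of_le_one_right ?_ ?_)
  · rw [hχ]
    positivity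
  · rw [div_le_one (by linarith)]
    exact hlogχ
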